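/- Let $m\ge 0$ be an integer, let $\mathfrak{h}\subset\mathfrak{sl}_m(\mathbb{C})$ be the Cartan subalgebra of traceless diagonal matrices, let $e_i\in\mathfrak{h}^*$ be the functional taking the $i$-th diagonal entry, and let $\Lambda\subset\mathfrak{h}^*$ be the integral weight lattice, that is, the group of functionals taking integer values on all coroots $E_{ii}-E_{jj}$. For $\lambda\in\Lambda$ let $\mathrm{M}(\lambda)$ be the Verma module of highest weight $\lambda$, that is, the quotient of $U(\mathfrak{sl}_m(\mathbb{C}))$ by the left ideal generated by the strictly upper triangular matrices and the elements $h-\lambda(h)\cdot 1$ for $h\in\mathfrak{h}$. For $\mu\in\Lambda$ let $\mathrm{M}(\lambda)_\mu=\{v\in \mathrm{M}(\lambda): hv=\mu(h)v \text{ for all } h\in\mathfrak{h}\}$ be the weight space of weight $\mu$, and for $i,j\in[m]$ write $\mu(i,j)=\mu+e_i-e_j$. Then, for all $\lambda,\mu\in\Lambda$, the weight space $\mathrm{M}(\lambda)_\mu$ is finite-dimensional, its dimension is the Kostant partition function value $p(\mu-\lambda)$, the number of ways to write $\mu-\lambda$ as a sum of negative roots $e_i-e_j$ ($i>j$) with multiplicities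 in $\mathbb{N}$, the order of the summands being irrelevant, and \[ (\dim \mathrm{M}(\lambda)_\mu)^2 \ \ge\ \dim \mathrm{M}(\lambda)_{\mu(i,j)}\cdot \dim \mathrm{M}(\lambda)_{\mu(j,i)}\qquad\text{for all } i,j\in[m]. \] -/

import Mathlib

noncomputable section

namespace VermaSl

open LieAlgebra.SpecialLinear

attribute [local instance 100] LieRing.ofAssociativeRing

/-- The Lie algebra `𝔰𝔩ₘ(ℂ)` of traceless complex matrices. -/
abbrev SL (m : ℕ) : LieSubalgebra ℂ (Matrix (Fin m) (Fin m) ℂ) := sl (Fin m) ℂ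

/-- The standard Cartan subalgebra `𝔥` of `𝔰𝔩ₘ(ℂ)`: the traceless diagonal matrices. -/
def cartan (m : ℕ) : LieSubalgebra ℂ (SL m) where
  carrier := {x | x.val.IsDiag}
  add_mem' hx hy := hx.add hy
  zero_mem' := Matrix.isDiag_zero
  smul_mem' c _ hx := hx.smul c
  lie_mem' := by
    intro x y hx hy
    change (x.val * y.val - y.val * x.val).IsDiag
    rw [← (Matrix.isDiag_iff_diagonal_diag _).1 hx, ← (Matrix.isDiag_iff_diagonal_diag _).1 hy,
      Matrix.diagonal_mul_diagonal, Matrix.diagonal_mul_diagonal]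
    exact (Matrix.isDiag_diagonal _).sub (Matrix.isDiag_diagonal _)

/-- The coroot `Eᵢᵢ - Eⱼⱼ`, as an element of the Cartan subalgebra. -/
def coroot {m : ℕ} (i j : Fin m) : cartan m :=
  ⟨singleSubSingle i j 1, by
    change (Matrix.single i i (1 : ℂ) - Matrix.single j j 1).IsDiag
    rw [← Matrix.diagonal_single, ← Matrix.diagonal_single]
    exact (Matrix.isDiag_diagonal _).sub (Matrix.isDiag_diagonal _)⟩

/-- The integral weight lattice `Λ ⊆ 𝔥*`: the functionals with integer values on all coroots. -/
def weightLattice (m : ℕ) : AddSubgroup (Module.Dual ℂ (cartan m)) where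
  carrier := {f | ∀ i j : Fin m, ∃ n : ℤ, f (coroot i j) = n}
  add_mem' := by
    intro f g hf hg i j
    obtain ⟨a, ha⟩ := hf i j
    obtain ⟨b, hb⟩ := hg i j
    exact ⟨a + b, by simp [ha, hb]⟩
  zero_mem' := fun _ _ => ⟨0, by simp⟩
  neg_mem' := by
    intro f hf i j
    obtain ⟨a, ha⟩ := hf i j
    exact ⟨-a, by simp [ha]⟩

/-- The integral weight `eᵢ`: the functional sending a traceless diagonal matrix to its `i`-th
diagonal entry. -/
def e {m : ℕ} (i : Fin m) : weightLattice m :=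
  ⟨{ toFun := fun h => h.val.val i i
     map_add' := fun _ _ => rfl
     map_smul' := fun _ _ => rfl }, by
    intro k l
    change ∃ n : ℤ, (Matrix.single k k 1 - Matrix.single l l 1 : Matrix (Fin m) (Fin m) ℂ) i i = n
    refine ⟨(Matrix.single k k 1 - Matrix.single l l 1 : Matrix (Fin m) (Fin m) ℤ) i i, ?_⟩
    simp only [Matrix.sub_apply, Matrix.single_apply]
    push_cast
    rfl⟩

/-- The weight `μ(i,j) = μ + eᵢ - eⱼ`. -/
def shift {m : ℕ} (μ : weightLattice m) (i j : Fin m) : weightLattice m := μ + e i - e j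

/-- The left ideal of `U(𝔰𝔩ₘ)` generated by the strictly upper triangular matrices and by the
elements `h - λ(h)·1` for `h` in the Cartan subalgebra. -/
def vermaIdeal {m : ℕ} (l : weightLattice m) :
    Submodule (UniversalEnvelopingAlgebra ℂ (SL m)) (UniversalEnvelopingAlgebra ℂ (SL m)) :=
  Submodule.span _
    ({u | ∃ x : SL m, (∀ i j : Fin m, j ≤ i → x.val i j = 0) ∧
        u = UniversalEnvelopingAlgebra.ι ℂ x} ∪
     {u | ∃ h : cartan m, u = UniversalEnvelopingAlgebra.ι ℂ (h : SL m) -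
        algebraMap ℂ (UniversalEnvelopingAlgebra ℂ (SL m)) (l.val h)})

/-- The Verma module `M(λ)`, the universal highest weight module of highest weight `λ`. -/
abbrev Verma {m : ℕ} (l : weightLattice m) : Type :=
  UniversalEnvelopingAlgebra ℂ (SL m) ⧸ vermaIdeal l

/-- `𝔰𝔩ₘ(ℂ)` acts on `M(λ)` through its universal enveloping algebra. -/
instance {m : ℕ} (l : weightLattice m) : LieRingModule (SL m) (Verma l) where
  bracket x v := UniversalEnvelopingAlgebra.ι ℂ x • v
  add_lie x y v := by
    change UniversalEnvelopingAlgebra.ι ℂ (x + y) • v = _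
    rw [map_add, add_smul]
  lie_add x v w := smul_add _ v w
  leibniz_lie x y v := by
    change UniversalEnvelopingAlgebra.ι ℂ x • UniversalEnvelopingAlgebra.ι ℂ y • v =
      UniversalEnvelopingAlgebra.ι ℂ ⁅x, y⁆ • v +
      UniversalEnvelopingAlgebra.ι ℂ y • UniversalEnvelopingAlgebra.ι ℂ x • v
    rw [LieHom.map_lie, LieRing.of_associative_ring_bracket, sub_smul, mul_smul, mul_smul,
      sub_add_cancel]

instance {m : ℕ} (l : weightLattice m) : LieModule ℂ (SL m) (Verma l) where
  smul_lie c x v := by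
    change UniversalEnvelopingAlgebra.ι ℂ (c • x) • v = c • UniversalEnvelopingAlgebra.ι ℂ x • v
    rw [map_smul, smul_assoc]
  lie_smul c x v := smul_comm (UniversalEnvelopingAlgebra.ι ℂ x) c v

/-- The weight space `M(λ)_μ = {v : h v = μ(h) v for all h ∈ 𝔥}`. -/
def vermaWeightSpace {m : ℕ} (l μ : weightLattice m) : Submodule ℂ (Verma l) :=
  (LieModule.weightSpace (L := cartan m) (Verma l) μ.val).toSubmodule

/-- The Kostant partition function: the number of ways to write `ν` as a sum of negative roots
`eᵢ - eⱼ`, `i > j`, the coefficient of each root being a natural number. -/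
def kostantPartition {m : ℕ} (ν : weightLattice m) : ℕ :=
  Nat.card {c : {p : Fin m × Fin m // p.2 < p.1} → ℕ //
    ∑ p, c p • (e p.val.1 - e p.val.2) = ν}

end VermaSl

end

/-!
Matrices act on the polynomial functions of a square matrix by left-invariant derivations `D_A`, and
every linear functional of `A` has the form `(D_A f)(1)` for some `f` that vanishes at the identity.
A product of `k` such derivations applied to `f ^ n` vanishes at the identity when `k < n`, and
takes the value `n! ∏ᵢ (D_{Aᵢ} f)(1)` when `k = n`; since monomials are linearly independent
functions, the ordered words in a basis of a linear Lie algebra are therefore linearly independent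
in its enveloping algebra. Hence the monomials in the negative root vectors form a basis of a Verma
module, and its weight spaces have the dimensions counted by the Kostant partition function.

Log-concavity of the number of ways to write a lattice vector in terms of vectors `eᵢ - eⱼ` comes
from the signature of a quadratic form, which goes back to the Lorentzian polynomials of Brändén
and Huh. The Gaussian `β ↦ q ^ |β|²`, `0 < q ≤ 1`, is a positive function for which every matrix
`(c (α + eᵢ + eⱼ))ᵢⱼ` has exactly one positive eigenvalue. Summing the translates of such a function
along a segment in the direction `eᵢ - eⱼ` preserves this property, because column `j` of one matrix
is column `i` of the next one. A `2 × 2` minor then gives the inequality, and `q → 0` replaces the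
Gaussian by the indicator function of the origin.
-/

noncomputable section

namespace PBW

open UniversalEnvelopingAlgebra LieModule

attribute [local instance 100] LieRing.ofAssociativeRing

section Spanning

variable (R : Type*) [CommRing R] {L : Type*} [LieRing L] [LieAlgebra R L] {κ : Type*}

/-- The product in `U(L)` of the letters of a word in the elements `x i` of `L`. -/
def wordProd (x : κ → L) (w : List κ) : UniversalEnvelopingAlgebra R L :=
  (w.map fun i => ι R (x i)).prod

/-- The standard filtration of `U(L)` by length: the span of the products of at most `k` of the
elements `x i`. -/
def lengthFiltration (x : κ → L) (k : ℕ) : Submodule R (UniversalEnvelopingAlgebra R L) :=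
  Submodule.span R (wordProd R x '' {w | w.length ≤ k})

@[simp]
theorem wordProd_nil (x : κ → L) : wordProd R x [] = 1 := rfl

@[simp]
theorem wordProd_cons (x : κ → L) (i : κ) (w : List κ) :
    wordProd R x (i :: w) = ι R (x i) * wordProd R x w := by
  simp [wordProd]

theorem wordProd_append (x : κ → L) (v w : List κ) :
    wordProd R x (v ++ w) = wordProd R x v * wordProd R x w := by
  simp [wordProd]

theorem adjoin_range_ι :
    Algebra.adjoin R (Set.range (ι R : L → UniversalEnvelopingAlgebra R L)) = ⊤ := by
  set S := Algebra.adjoin R (Set.range (ι R : L → UniversalEnvelopingAlgebra R L))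
  let f : L →ₗ⁅R⁆ S :=
    { toFun x := ⟨ι R x, Algebra.subset_adjoin ⟨x, rfl⟩⟩
      map_add' x y := Subtype.ext (map_add (ι R) x y)
      map_smul' c x := Subtype.ext (map_smul (ι R) c x)
      map_lie' {x y} := Subtype.ext (LieHom.map_lie (ι R) x y) }
  have h : S.val.comp (lift R f) = AlgHom.id R _ := by
    ext x
    change S.val (lift R f (ι R x)) = ι R x
    rw [lift_ι_apply]
    rfl
  refine Algebra.eq_top_iff.2 fun u => ?_
  rw [← AlgHom.id_apply (R := R) u, ← h]
  exact (lift R f u).2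

variable {x : κ → L}

theorem ι_mem_span_range (hx : Submodule.span R (Set.range x) = ⊤) (y : L) :
    ι R y ∈ Submodule.span R (Set.range fun i => ι R (x i)) := by
  have hy : y ∈ Submodule.span R (Set.range x) := hx ▸ Submodule.mem_top
  have := Submodule.mem_map_of_mem (f := (ι R).toLinearMap) hy
  rwa [Submodule.map_span, ← Set.range_comp] at this

theorem span_range_wordProd (hx : Submodule.span R (Set.range x) = ⊤) :
    Submodule.span R (Set.range (wordProd R x)) = ⊤ := by
  have hadjoin : Algebra.adjoin R (Set.range fun i => ι R (x i)) = ⊤ := by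
    rw [eq_top_iff, ← adjoin_range_ι, Algebra.adjoin_le_iff]
    rintro _ ⟨y, rfl⟩
    exact Algebra.span_le_adjoin R _ (ι_mem_span_range R hx y)
  rw [← Algebra.top_toSubmodule, ← hadjoin, Algebra.adjoin_eq_span]
  congr 1
  rw [← FreeMonoid.mrange_lift, MonoidHom.coe_mrange]
  exact congrArg Set.range (funext fun w => (FreeMonoid.lift_apply _ w).symm)

theorem ι_mul_mem_lengthFiltration (hx : Submodule.span R (Set.range x) = ⊤) (y : L) {k : ℕ}
    {u : UniversalEnvelopingAlgebra R L} (hu : u ∈ lengthFiltration R x k) :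
    ι R y * u ∈ lengthFiltration R x (k + 1) := by
  have h := Submodule.mul_mem_mul (ι_mem_span_range R hx y) hu
  rw [lengthFiltration, Submodule.span_mul_span] at h
  refine Submodule.span_mono ?_ h
  rintro _ ⟨_, ⟨i, rfl⟩, _, ⟨w, hw, rfl⟩, rfl⟩
  exact ⟨i :: w, Nat.succ_le_succ hw, wordProd_cons R x i w⟩

theorem wordProd_sub_wordProd_mem_lengthFiltration (hx : Submodule.span R (Set.range x) = ⊤)
    {v w : List κ} (h : v.Perm w) {k : ℕ} (hk : v.length ≤ k + 1) :
    wordProd R x v - wordProd R x w ∈ lengthFiltration R x k := by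
  induction h generalizing k with
  | nil => simp
  | @cons i v w h ih =>
    rw [wordProd_cons, wordProd_cons, ← mul_sub]
    cases k with
    | zero =>
      obtain rfl : v = [] := List.eq_nil_of_length_eq_zero (by simpa using hk)
      simp [h.nil_eq]
    | succ k => exact ι_mul_mem_lengthFiltration R hx _ (ih (by simpa using hk))
  | swap i j w =>
    have hcomm : wordProd R x (j :: i :: w) - wordProd R x (i :: j :: w) =
        ι R ⁅x j, x i⁆ * wordProd R x w := by
      simp only [wordProd_cons, LieHom.map_lie, LieRing.of_associative_ring_bracket, sub_mul,
        mul_assoc]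
    obtain ⟨k, rfl⟩ : ∃ l, k = l + 1 := Nat.exists_eq_add_one.2 (by simp at hk; omega)
    rw [hcomm]
    exact ι_mul_mem_lengthFiltration R hx _
      (Submodule.subset_span ⟨w, by simpa using hk, rfl⟩)
  | trans h₁ _ ih₁ ih₂ =>
    rw [← sub_add_sub_cancel]
    exact add_mem (ih₁ hk) (ih₂ (h₁.length_eq ▸ hk))

theorem span_range_wordProd_arrangement (hx : Submodule.span R (Set.range x) = ⊤)
    {w : Multiset κ → List κ} (hw : ∀ s, (w s : Multiset κ) = s) :
    Submodule.span R (Set.range fun s => wordProd R x (w s)) = ⊤ := by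
  set M := Submodule.span R (Set.range fun s => wordProd R x (w s))
  have hmem (v : List κ) : wordProd R x (w v) ∈ M := Submodule.subset_span ⟨v, rfl⟩
  have hperm (v : List κ) : v.Perm (w v) := Multiset.coe_eq_coe.1 (hw v).symm
  have hfilt (k : ℕ) : lengthFiltration R x k ≤ M := by
    induction k with
    | zero =>
      refine Submodule.span_le.2 ?_
      rintro _ ⟨v, hv, rfl⟩
      obtain rfl : v = [] := List.eq_nil_of_length_eq_zero (Nat.le_zero.1 hv)
      have h := hmem []
      rwa [← (hperm []).nil_eq] at h
    | succ k ih =>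
      refine Submodule.span_le.2 ?_
      rintro _ ⟨v, hv, rfl⟩
      rw [← sub_add_cancel (wordProd R x v) (wordProd R x (w v))]
      exact add_mem (ih (wordProd_sub_wordProd_mem_lengthFiltration R hx (hperm v) hv)) (hmem v)
  rw [eq_top_iff, ← span_range_wordProd R hx, Submodule.span_le]
  rintro _ ⟨v, rfl⟩
  exact hfilt v.length (Submodule.subset_span ⟨v, le_refl v.length, rfl⟩)

end Spanning

section Derivations

variable {R S : Type*} [CommRing R] [CommRing S] [Algebra R S]

theorem derivation_mem_pow (D : Derivation R S S) {I : Ideal S} {k : ℕ} {f : S}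
    (hf : f ∈ I ^ (k + 1)) : D f ∈ I ^ k := by
  induction k generalizing f with
  | zero => simp
  | succ k ih =>
    rw [pow_succ' I (k + 1)] at hf
    induction hf using Submodule.mul_induction_on' with
    | mem_mul_mem a ha b hb =>
      rw [Derivation.leibniz, smul_eq_mul, smul_eq_mul]
      refine add_mem ?_ (Ideal.mul_mem_right _ _ hb)
      rw [pow_succ' I k]
      exact Ideal.mul_mem_mul ha (ih hb)
    | add a _ b _ ha hb => rw [map_add]; exact add_mem ha hb

theorem prod_derivations_mem_pow (Ds : List (Derivation R S S)) {I : Ideal S} {k : ℕ} {f : S}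
    (hf : f ∈ I ^ (k + Ds.length)) :
    (Ds.map (toEnd R (Derivation R S S) S)).prod f ∈ I ^ k := by
  induction Ds generalizing k with
  | nil => exact hf
  | cons D Ds ih =>
    rw [List.map_cons, List.prod_cons]
    exact derivation_mem_pow D (ih (by rwa [List.length_cons, ← add_assoc, add_right_comm] at hf))

variable (ε : S →ₐ[R] R)

theorem apply_prod_derivations_eq_zero {Ds : List (Derivation R S S)} {k : ℕ}
    (hk : Ds.length < k) {f : S} (hf : f ∈ RingHom.ker ε ^ k) :
    ε ((Ds.map (toEnd R (Derivation R S S) S)).prod f) = 0 := by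
  have h := prod_derivations_mem_pow Ds (k := 1) (Ideal.pow_le_pow_right (by omega) hf)
  rwa [pow_one] at h

theorem derivation_pow_sub_mem (D : Derivation R S S) {f : S} (hf : ε f = 0) (n : ℕ) :
    D (f ^ (n + 1)) - ((n + 1) * ε (D f)) • f ^ n ∈ RingHom.ker ε ^ (n + 1) := by
  have hDf : (n + 1 : S) * (D f - algebraMap R S (ε (D f))) ∈ RingHom.ker ε := by
    simp [RingHom.mem_ker]
  have := Ideal.mul_mem_mul (Ideal.pow_mem_pow (show f ∈ RingHom.ker ε from hf) n) hDf
  rw [← pow_succ] at this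
  convert this using 1
  rw [Derivation.leibniz_pow, nsmul_eq_mul, smul_eq_mul, add_tsub_cancel_right, Nat.cast_add_one,
    Algebra.smul_def, map_mul, map_add, map_natCast, map_one]
  ring

theorem apply_prod_derivations_pow_length (Ds : List (Derivation R S S)) {f : S} (hf : ε f = 0) :
    ε ((Ds.map (toEnd R (Derivation R S S) S)).prod (f ^ Ds.length)) =
      Ds.length.factorial * (Ds.map fun D => ε (D f)).prod := by
  induction Ds using List.reverseRecOn with
  | nil => simp
  | append_singleton Ds D ih =>
    have h := apply_prod_derivations_eq_zero ε (Nat.lt_succ_self Ds.length)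
      (derivation_pow_sub_mem ε D hf Ds.length)
    rw [map_sub, map_sub, map_smul, map_smul, ih, sub_eq_zero] at h
    simp only [List.map_append, List.map_cons, List.map_nil, List.prod_append, List.prod_singleton,
      Module.End.mul_apply, List.length_append, List.length_singleton, toEnd_apply_apply,
      Derivation.bracket_eq_fun, h, Nat.factorial_succ, smul_eq_mul]
    push_cast
    ring

end Derivations

section Independence

theorem linearIndependent_multiset_prod {R κ : Type*} [CommRing R] [IsDomain R] [Infinite R] :
    LinearIndependent R fun (s : Multiset κ) (t : κ → R) => (s.map t).prod := by
  classical
  let evalₗ : MvPolynomial κ R →ₗ[R] (κ → R) → R :=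
    LinearMap.pi fun t => (MvPolynomial.aeval t).toLinearMap
  have hker : LinearMap.ker evalₗ = ⊥ :=
    LinearMap.ker_eq_bot.2 fun p q h => MvPolynomial.funext fun t => congrFun h t
  have heval : (fun (s : Multiset κ) (t : κ → R) => (s.map t).prod) =
      (evalₗ ∘ MvPolynomial.basisMonomials κ R) ∘ Multiset.toFinsupp := by
    funext s t
    simp only [evalₗ, Function.comp_apply, MvPolynomial.coe_basisMonomials, LinearMap.pi_apply,
      AlgHom.toLinearMap_apply, MvPolynomial.aeval_monomial, map_one, one_mul]
    exact Finset.prod_multiset_map_count s t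
  rw [heval]
  exact ((MvPolynomial.basisMonomials κ R).linearIndependent.map' evalₗ hker).comp _
    Multiset.toFinsupp.injective

variable {R S L κ : Type*} [CommRing R] [CommRing S] [Algebra R S] [LieRing L] [LieAlgebra R L]

theorem apply_lift_wordProd_pow (ρ : L →ₗ⁅R⁆ Derivation R S S) (ε : S →ₐ[R] R) (x : κ → L) {f : S}
    (hf : ε f = 0) {w : List κ} {n : ℕ} (hn : w.length ≤ n) :
    ε (lift R ((toEnd R (Derivation R S S) S).comp ρ) (wordProd R x w) (f ^ n)) =
      if w.length = n then n.factorial * (w.map fun i => ε (ρ (x i) f)).prod else 0 := by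
  have hprod : lift R ((toEnd R (Derivation R S S) S).comp ρ) (wordProd R x w) =
      ((w.map fun i => ρ (x i)).map (toEnd R (Derivation R S S) S)).prod := by
    rw [wordProd, map_list_prod, List.map_map, List.map_map]
    exact congrArg List.prod (List.map_congr_left fun i _ => lift_ι_apply R _ (x i))
  have hlen : (w.map fun i => ρ (x i)).length = w.length := List.length_map _
  rw [hprod]
  split_ifs with h
  · rw [← h, ← hlen, apply_prod_derivations_pow_length ε _ hf, List.map_map]
    rfl
  · exact apply_prod_derivations_eq_zero ε (hlen ▸ lt_of_le_of_ne hn h) (Ideal.pow_mem_pow hf n)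

theorem linearIndependent_of_leading_terms {R M V σ : Type*} [Ring R] [AddCommGroup M] [Module R M]
    [AddCommGroup V] [Module R V] {v : σ → M} (deg : σ → ℕ) (φ : ℕ → M →ₗ[R] V)
    (hlt : ∀ n s, deg s < n → φ n (v s) = 0)
    (hlead : ∀ n, LinearIndepOn R (fun s => φ n (v s)) {s | deg s = n}) :
    LinearIndependent R v := by
  classical
  rw [linearIndependent_iff]
  intro c hc
  by_contra hne
  obtain ⟨s₀, hs₀, hmax⟩ := c.support.exists_max_image deg (Finsupp.support_nonempty_iff.2 hne)
  have htop : Finsupp.linearCombination R (fun s => φ (deg s₀) (v s))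
      (c.filter fun s => deg s = deg s₀) = 0 := by
    rw [← map_zero (φ (deg s₀)), ← hc, Finsupp.linearCombination_apply,
      Finsupp.linearCombination_apply, Finsupp.sum, Finsupp.sum, map_sum, Finsupp.support_filter,
      Finset.sum_filter]
    refine Finset.sum_congr rfl fun s hs => ?_
    rw [map_smul]
    split_ifs with h
    · rw [Finsupp.filter_apply, if_pos h]
    · rw [hlt _ s (lt_of_le_of_ne (hmax s hs) h), smul_zero]
  have hzero := linearIndepOn_iff.1 (hlead (deg s₀)) (c.filter fun s => deg s = deg s₀)
    ((Finsupp.mem_supported' R _).2 fun s hs => Finsupp.filter_apply_neg _ _ hs) htop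
  refine Finsupp.mem_support_iff.1 hs₀ ?_
  rw [← Finsupp.filter_apply_pos (fun s => deg s = deg s₀) c rfl, hzero, Finsupp.zero_apply]

theorem linearIndependent_wordProd [IsDomain R] [CharZero R] (ρ : L →ₗ⁅R⁆ Derivation R S S)
    (ε : S →ₐ[R] R) {x : κ → L}
    (hx : ∀ t : κ → R, ∃ f, ε f = 0 ∧ ∀ i, ε (ρ (x i) f) = t i)
    {w : Multiset κ → List κ} (hw : ∀ s, (w s : Multiset κ) = s) :
    LinearIndependent R fun s => wordProd R x (w s) := by
  choose f hf hft using hx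
  let φ (n : ℕ) : UniversalEnvelopingAlgebra R L →ₗ[R] (κ → R) → R :=
    LinearMap.pi fun t => ε.toLinearMap ∘ₗ LinearMap.applyₗ (f t ^ n) ∘ₗ
      (lift R ((toEnd R (Derivation R S S) S).comp ρ)).toLinearMap
  have hlen (s : Multiset κ) : (w s).length = s.card := by rw [← Multiset.coe_card, hw]
  have hφ {n : ℕ} {s : Multiset κ} (hs : s.card ≤ n) (t : κ → R) : φ n (wordProd R x (w s)) t =
      if s.card = n then n.factorial * (s.map t).prod else 0 := by
    have hmap : ((w s).map t).prod = (s.map t).prod := by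
      rw [← Multiset.prod_coe, ← Multiset.map_coe, hw]
    refine (apply_lift_wordProd_pow ρ ε x (hf t) ((hlen s).trans_le hs)).trans ?_
    simp only [hlen, hft, hmap]
  refine linearIndependent_of_leading_terms Multiset.card φ (fun n s hs => ?_) fun n => ?_
  · funext t
    rw [hφ hs.le, if_neg hs.ne, Pi.zero_apply]
  · have hinj : LinearMap.ker (LinearMap.lsmul R ((κ → R) → R) (n.factorial : R)) = ⊥ :=
      LinearMap.ker_lsmul (Nat.cast_ne_zero.2 n.factorial_ne_zero)
    have hscaled := (linearIndependent_multiset_prod (R := R) (κ := κ)).map' _ hinj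
    refine (hscaled.linearIndepOn _).congr (w := fun s => φ n (wordProd R x (w s)))
      fun s (hs : s.card = n) => funext fun t => ?_
    exact ((hφ hs.le t).trans (if_pos hs)).symm

end Independence

section Matrices

open MvPolynomial Matrix

variable {R n : Type*} [CommRing R] [Fintype n]

/-- The matrix `y A`, where `y` is the generic matrix: its entries are the polynomial functions
`y ↦ (y A) i j`. -/
def genericMul (A : Matrix n n R) : Matrix n n (MvPolynomial (n × n) R) :=
  mvPolynomialX n n R * A.map C

theorem genericMul_apply (A : Matrix n n R) (i j : n) :
    genericMul A i j = ∑ k, A k j • X (i, k) := by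
  simp [genericMul, Matrix.mul_apply, mul_comm, MvPolynomial.smul_eq_C_mul]

/-- The derivation `f ↦ d/ds f(y (1 + s A))` at `s = 0` of the polynomial functions `f` of a square
matrix `y`: the vector field on the group of invertible matrices which is invariant under left
translations and takes the value `A` at the identity. -/
def invariantDerivation (A : Matrix n n R) :
    Derivation R (MvPolynomial (n × n) R) (MvPolynomial (n × n) R) :=
  mkDerivation R fun p => genericMul A p.1 p.2

theorem invariantDerivation_X (A : Matrix n n R) (i j : n) :
    invariantDerivation A (X (i, j)) = genericMul A i j :=
  mkDerivation_X _ _ _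

theorem invariantDerivation_genericMul (A B : Matrix n n R) (i j : n) :
    invariantDerivation A (genericMul B i j) = genericMul (A * B) i j := by
  simp only [genericMul_apply, map_sum, Derivation.map_smul, invariantDerivation_X,
    Finset.smul_sum, Matrix.mul_apply, Finset.sum_smul, smul_smul, mul_comm]
  exact Finset.sum_comm

variable [DecidableEq n]

/-- The action of the Lie algebra of square matrices on the polynomial functions of a square matrix
by left-invariant derivations. -/
def invariantDerivationHom :
    Matrix n n R →ₗ⁅R⁆ Derivation R (MvPolynomial (n × n) R) (MvPolynomial (n × n) R) where
  toFun := invariantDerivation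
  map_add' A B := derivation_ext fun ⟨i, j⟩ => by
    simp only [Derivation.add_apply, invariantDerivation_X, genericMul_apply, Matrix.add_apply,
      add_smul, Finset.sum_add_distrib]
  map_smul' c A := derivation_ext fun ⟨i, j⟩ => by
    simp only [RingHom.id_apply, Derivation.smul_apply, invariantDerivation_X, genericMul_apply,
      Matrix.smul_apply, smul_assoc, Finset.smul_sum]
  map_lie' {A B} := derivation_ext fun ⟨i, j⟩ => by
    rw [Derivation.commutator_apply, invariantDerivation_X, invariantDerivation_X,
      invariantDerivation_X, invariantDerivation_genericMul, invariantDerivation_genericMul,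
      LieRing.of_associative_ring_bracket]
    simp only [genericMul_apply, Matrix.sub_apply, sub_smul, Finset.sum_sub_distrib]

/-- Evaluation of polynomial functions at the identity matrix. -/
def evalOne : MvPolynomial (n × n) R →ₐ[R] R := aeval fun p => (1 : Matrix n n R) p.1 p.2

theorem evalOne_invariantDerivation_X (A : Matrix n n R) (i j : n) :
    evalOne (invariantDerivation A (X (i, j))) = A i j := by
  simp [invariantDerivation_X, genericMul_apply, evalOne, Matrix.one_apply]

theorem exists_evalOne_invariantDerivation_eq (ξ : Module.Dual R (Matrix n n R)) :
    ∃ f, evalOne f = 0 ∧ ∀ A, evalOne (invariantDerivation A f) = ξ A := by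
  refine ⟨∑ i, ∑ j, ξ (single i j 1) • (X (i, j) - C ((1 : Matrix n n R) i j)), ?_, fun A => ?_⟩
  · simp [evalOne]
  · conv_rhs => rw [matrix_eq_sum_single A]
    simp only [map_sum, map_smul, map_sub, Derivation.map_smul]
    refine Finset.sum_congr rfl fun i _ => Finset.sum_congr rfl fun j _ => ?_
    have hsingle : single i j (A i j) = A i j • single i j (1 : R) := by
      rw [smul_single, smul_eq_mul, mul_one]
    rw [hsingle, map_smul, evalOne_invariantDerivation_X, derivation_C, map_zero, sub_zero,
      smul_eq_mul, smul_eq_mul, mul_comm]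

end Matrices

section MatrixLieAlgebras

variable {K L n κ : Type*} [Field K] [CharZero K] [LieRing L] [LieAlgebra K L] [Fintype n]
  [DecidableEq n]

theorem linearIndependent_wordProd_of_matrix (ρ : L →ₗ⁅K⁆ Matrix n n K) {x : κ → L}
    (hx : LinearIndependent K fun i => ρ (x i)) {w : Multiset κ → List κ}
    (hw : ∀ s, (w s : Multiset κ) = s) : LinearIndependent K fun s => wordProd K x (w s) := by
  refine linearIndependent_wordProd (invariantDerivationHom.comp ρ) evalOne (fun t => ?_) hw
  obtain ⟨ξ, hξ⟩ := ((Module.Basis.span hx).constr K t).exists_extend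
  have hξt (i : κ) : ξ (ρ (x i)) = t i := by
    rw [← (Module.Basis.span hx).constr_basis K t i, ← hξ, LinearMap.comp_apply,
      Submodule.subtype_apply, Module.Basis.span_apply]
  obtain ⟨f, hf, hfξ⟩ := exists_evalOne_invariantDerivation_eq ξ
  exact ⟨f, hf, fun i => (hfξ _).trans (hξt i)⟩

/-- The Poincaré–Birkhoff–Witt basis of `U(L)` attached to a basis of `L` and a choice `w` of an
arrangement of each multiset of indices, for a linear Lie algebra `L` in characteristic zero. -/
def basis (ρ : L →ₗ⁅K⁆ Matrix n n K) (hρ : Function.Injective ρ) (b : Module.Basis κ K L)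
    {w : Multiset κ → List κ} (hw : ∀ s, (w s : Multiset κ) = s) :
    Module.Basis (Multiset κ) K (UniversalEnvelopingAlgebra K L) :=
  .mk (linearIndependent_wordProd_of_matrix ρ
      (b.linearIndependent.map' ρ.toLinearMap (LinearMap.ker_eq_bot.2 hρ)) hw)
    (span_range_wordProd_arrangement K b.span_eq hw).ge

theorem basis_apply (ρ : L →ₗ⁅K⁆ Matrix n n K) (hρ : Function.Injective ρ)
    (b : Module.Basis κ K L) {w : Multiset κ → List κ} (hw : ∀ s, (w s : Multiset κ) = s)
    (s : Multiset κ) : basis ρ hρ b hw s = wordProd K b (w s) :=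
  Module.Basis.mk_apply _ _ s

end MatrixLieAlgebras

end PBW

namespace InducedModule

open UniversalEnvelopingAlgebra PBW

attribute [local instance 100] LieRing.ofAssociativeRing

section Character

variable {R L : Type*} [CommRing R] [LieRing L] [LieAlgebra R L] {B : LieSubalgebra R L}

/-- The canonical homomorphism `U(B) → U(L)` of a Lie subalgebra `B` of `L`. -/
def envelopingIncl (B : LieSubalgebra R L) :
    UniversalEnvelopingAlgebra R B →ₐ[R] UniversalEnvelopingAlgebra R L :=
  lift R ((ι R).comp B.incl)

theorem envelopingIncl_ι (y : B) : envelopingIncl B (ι R y) = ι R (y : L) :=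
  lift_ι_apply R _ y

theorem envelopingIncl_wordProd {κ : Type*} (x : κ → B) (w : List κ) :
    envelopingIncl B (wordProd R x w) = wordProd R (fun i => (x i : L)) w := by
  simp only [wordProd, map_list_prod, List.map_map, Function.comp_def, envelopingIncl_ι]

/-- The left ideal of `U(L)` generated by the elements `y - χ(y)·1` for `y` in `B`. The quotient of
`U(L)` by it is the `L`-module induced from the character `χ` of `B`. -/
def characterIdeal (χ : B →ₗ⁅R⁆ R) :
    Submodule (UniversalEnvelopingAlgebra R L) (UniversalEnvelopingAlgebra R L) :=
  Submodule.span _ (Set.range fun y : B => ι R (y : L) - algebraMap R _ (χ y))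

/-- The quotient map of `U(L)` onto the module induced from a character. -/
def toInduced (χ : B →ₗ⁅R⁆ R) :
    UniversalEnvelopingAlgebra R L →ₗ[R] UniversalEnvelopingAlgebra R L ⧸ characterIdeal χ :=
  (characterIdeal χ).mkQ.restrictScalars R

theorem toInduced_mul (χ : B →ₗ⁅R⁆ R) (u v : UniversalEnvelopingAlgebra R L) :
    toInduced χ (u * v) = u • toInduced χ v := rfl

theorem toInduced_mul_ι (χ : B →ₗ⁅R⁆ R) (u : UniversalEnvelopingAlgebra R L) (y : B) :
    toInduced χ (u * ι R (y : L)) = χ y • toInduced χ u := by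
  have hy : ι R (y : L) - algebraMap R _ (χ y) ∈ characterIdeal χ :=
    Submodule.subset_span ⟨y, rfl⟩
  rw [← map_smul, ← sub_eq_zero, ← map_sub, Algebra.smul_def, Algebra.commutes, ← mul_sub,
    toInduced_mul]
  exact (congrArg (u • ·) ((Submodule.Quotient.mk_eq_zero _).2 hy)).trans (smul_zero u)

theorem toInduced_mul_envelopingIncl (χ : B →ₗ⁅R⁆ R) (u : UniversalEnvelopingAlgebra R L)
    (v : UniversalEnvelopingAlgebra R B) :
    toInduced χ (u * envelopingIncl B v) = lift R χ v • toInduced χ u := by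
  have hv : v ∈ Algebra.adjoin R (Set.range (ι R : B → UniversalEnvelopingAlgebra R B)) := by
    rw [adjoin_range_ι]
    exact Algebra.mem_top
  induction hv using Algebra.adjoin_induction generalizing u with
  | mem _ hy =>
    obtain ⟨y, rfl⟩ := hy
    rw [envelopingIncl_ι, toInduced_mul_ι, lift_ι_apply]
  | algebraMap r =>
    rw [AlgHom.commutes, AlgHom.commutes, ← Algebra.commutes, ← Algebra.smul_def, map_smul]
    rfl
  | add v w _ _ hv hw => rw [map_add, mul_add, map_add, hv, hw, map_add, add_smul]
  | mul v w _ _ hv hw =>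
    rw [map_mul (envelopingIncl B), ← mul_assoc, hw, hv, smul_smul, map_mul, mul_comm]

theorem characterIdeal_le_ker {V : Type*} [AddCommGroup V] [Module R V] {χ : B →ₗ⁅R⁆ R}
    {π : UniversalEnvelopingAlgebra R L →ₗ[R] V}
    (hπ : ∀ u (y : B), π (u * ι R (y : L)) = χ y • π u) :
    (characterIdeal χ).restrictScalars R ≤ LinearMap.ker π := by
  intro u (hu : u ∈ characterIdeal χ)
  suffices h : ∀ v, π (v * u) = 0 by simpa using h 1
  induction hu using Submodule.span_induction with
  | mem u hu =>
    obtain ⟨y, rfl⟩ := hu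
    intro v
    rw [mul_sub, map_sub, hπ, ← Algebra.commutes, ← Algebra.smul_def, map_smul, sub_self]
  | zero => simp
  | add u v _ _ hu hv =>
    intro z
    rw [mul_add, map_add, hu, hv, add_zero]
  | smul c u _ hu =>
    intro z
    rw [smul_eq_mul, ← mul_assoc, hu]

theorem ι_mul_wordProd {κ : Type*} {x : κ → L} {h : L} {α : κ → R}
    (hα : ∀ i, ⁅h, x i⁆ = α i • x i) (w : List κ) :
    ι R h * wordProd R x w = wordProd R x w * ι R h + (w.map α).sum • wordProd R x w := by
  induction w with
  | nil => simp
  | cons i w ih =>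
    have hcomm : ι R h * ι R (x i) = ι R (x i) * ι R h + α i • ι R (x i) := by
      rw [← map_smul, ← hα, LieHom.map_lie, LieRing.of_associative_ring_bracket]
      abel
    rw [wordProd_cons, ← mul_assoc, hcomm, add_mul, mul_assoc, ih, mul_add, List.map_cons,
      List.sum_cons, add_smul, smul_mul_assoc, mul_smul_comm, mul_assoc]
    abel

end Character

section LeftFirst

variable {R L κ κ' : Type*} [CommRing R] [LieRing L] [LieAlgebra R L] {B : LieSubalgebra R L}

theorem filterMap_getLeft?_disjSum (s : Multiset κ) (t : Multiset κ') :
    (s.disjSum t).filterMap Sum.getLeft? = s := by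
  have ht : (t.filterMap fun _ => none : Multiset κ) = 0 :=
    Multiset.eq_zero_of_forall_notMem (by simp)
  rw [Multiset.disjSum, Multiset.filterMap_add, Multiset.filterMap_map, Multiset.filterMap_map]
  simp only [Function.comp_def, Sum.getLeft?_inl, Sum.getLeft?_inr, Multiset.filterMap_some, ht,
    add_zero]

theorem filterMap_getRight?_disjSum (s : Multiset κ) (t : Multiset κ') :
    (s.disjSum t).filterMap Sum.getRight? = t := by
  have hs : (s.filterMap fun _ => none : Multiset κ') = 0 :=
    Multiset.eq_zero_of_forall_notMem (by simp)
  rw [Multiset.disjSum, Multiset.filterMap_add, Multiset.filterMap_map, Multiset.filterMap_map]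
  simp only [Function.comp_def, Sum.getRight?_inl, Sum.getRight?_inr, Multiset.filterMap_some, hs,
    zero_add]

/-- The arrangement of a multiset over `κ ⊕ κ'` in which the elements of `κ` come first. -/
def leftFirst (s : Multiset (κ ⊕ κ')) : List (κ ⊕ κ') :=
  (s.filterMap Sum.getLeft?).toList.map Sum.inl ++ (s.filterMap Sum.getRight?).toList.map Sum.inr

theorem coe_leftFirst (s : Multiset (κ ⊕ κ')) : (leftFirst s : Multiset (κ ⊕ κ')) = s := by
  rw [leftFirst, ← Multiset.coe_add, ← Multiset.map_coe, ← Multiset.map_coe, Multiset.coe_toList,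
    Multiset.coe_toList]
  induction s using Multiset.induction_on with
  | empty => rfl
  | cons i s ih =>
    nth_rw 3 [← ih]
    cases i <;> simp [Multiset.filterMap_cons]

variable {b : Module.Basis (κ ⊕ κ') R L} {c : Module.Basis κ' R B}

theorem wordProd_leftFirst (hbc : ∀ i, b (Sum.inr i) = c i) (s : Multiset (κ ⊕ κ')) :
    wordProd R b (leftFirst s) =
      wordProd R (b ∘ Sum.inl) (s.filterMap Sum.getLeft?).toList *
        envelopingIncl B (wordProd R c (s.filterMap Sum.getRight?).toList) := by
  rw [leftFirst, wordProd_append, envelopingIncl_wordProd]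
  simp only [wordProd, List.map_map, Function.comp_def, hbc]

theorem span_range_toInduced_wordProd (hbc : ∀ i, b (Sum.inr i) = c i) (χ : B →ₗ⁅R⁆ R) :
    Submodule.span R (Set.range fun s =>
      toInduced χ (wordProd R (b ∘ Sum.inl) (Multiset.toList s))) = ⊤ := by
  have hsurj : LinearMap.range (toInduced χ) = ⊤ :=
    LinearMap.range_eq_top.2 (Submodule.Quotient.mk_surjective _)
  rw [eq_top_iff, ← hsurj, LinearMap.range_eq_map,
    ← span_range_wordProd_arrangement R b.span_eq coe_leftFirst, Submodule.map_span_le]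
  rintro _ ⟨s, rfl⟩
  dsimp only
  rw [wordProd_leftFirst hbc, toInduced_mul_envelopingIncl]
  exact Submodule.smul_mem _ _ (Submodule.subset_span ⟨_, rfl⟩)

end LeftFirst

section Basis

variable {K L n κ κ' : Type*} [Field K] [CharZero K] [LieRing L] [LieAlgebra K L]
  {B : LieSubalgebra K L} [Fintype n] [DecidableEq n] {ρ : L →ₗ⁅K⁆ Matrix n n K}
  {b : Module.Basis (κ ⊕ κ') K L} {c : Module.Basis κ' K B}

theorem exists_apply_wordProd_mul_envelopingIncl (hρ : Function.Injective ρ)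
    (hbc : ∀ i, b (Sum.inr i) = c i) (χ : B →ₗ⁅K⁆ K) :
    ∃ π : UniversalEnvelopingAlgebra K L →ₗ[K] Multiset κ →₀ K, ∀ s v,
      π (wordProd K (b ∘ Sum.inl) (Multiset.toList s) * envelopingIncl B v) =
        Finsupp.single s (lift K χ v) := by
  let img (s : Multiset (κ ⊕ κ')) : Multiset κ →₀ K := Finsupp.single (s.filterMap Sum.getLeft?)
    (lift K χ (wordProd K c (s.filterMap Sum.getRight?).toList))
  let π := (PBW.basis ρ hρ b coe_leftFirst).constr K img
  refine ⟨π, fun s v => ?_⟩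
  suffices h : π ∘ₗ LinearMap.mulLeft K (wordProd K (b ∘ Sum.inl) s.toList) ∘ₗ
      (envelopingIncl B).toLinearMap = Finsupp.lsingle s ∘ₗ (lift K χ).toLinearMap from
    LinearMap.congr_fun h v
  refine LinearMap.ext_on_range
    (span_range_wordProd_arrangement K c.span_eq Multiset.coe_toList) fun t => ?_
  have h := (PBW.basis ρ hρ b coe_leftFirst).constr_basis K img (s.disjSum t)
  dsimp only [img] at h
  rwa [basis_apply, wordProd_leftFirst hbc, filterMap_getLeft?_disjSum,
    filterMap_getRight?_disjSum] at h

theorem linearIndependent_toInduced_wordProd (hρ : Function.Injective ρ)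
    (hbc : ∀ i, b (Sum.inr i) = c i) (χ : B →ₗ⁅K⁆ K) :
    LinearIndependent K fun s =>
      toInduced χ (wordProd K (b ∘ Sum.inl) (Multiset.toList s)) := by
  obtain ⟨π, hπ⟩ := exists_apply_wordProd_mul_envelopingIncl hρ hbc χ
  have hχ (u) (y : B) : π (u * ι K (y : L)) = χ y • π u := by
    suffices h : π ∘ₗ LinearMap.mulRight K (ι K (y : L)) = χ y • π from LinearMap.congr_fun h u
    refine LinearMap.ext_on_range
      (span_range_wordProd_arrangement K b.span_eq coe_leftFirst) fun s => ?_
    rw [wordProd_leftFirst hbc, LinearMap.comp_apply, LinearMap.mulRight_apply, mul_assoc,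
      ← envelopingIncl_ι, ← map_mul, LinearMap.smul_apply, hπ, hπ, map_mul, lift_ι_apply, mul_comm,
      Finsupp.smul_single, smul_eq_mul]
  let πbar := Submodule.liftQ ((characterIdeal χ).restrictScalars K) π (characterIdeal_le_ker hχ)
  have hπbar : (πbar ∘ fun s => toInduced χ (wordProd K (b ∘ Sum.inl) (Multiset.toList s))) =
      fun s => Finsupp.single s 1 := by
    funext s
    have h := hπ s 1
    rwa [map_one, mul_one, map_one] at h
  exact .of_comp πbar (hπbar ▸ Finsupp.linearIndependent_single_one K (Multiset κ))

/-- The basis of the module induced from a character of `B`, made of the words in a basis of a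
complement of `B`. -/
def basis (hρ : Function.Injective ρ) (hbc : ∀ i, b (Sum.inr i) = c i) (χ : B →ₗ⁅K⁆ K) :
    Module.Basis (Multiset κ) K (UniversalEnvelopingAlgebra K L ⧸ characterIdeal χ) :=
  .mk (linearIndependent_toInduced_wordProd hρ hbc χ) (span_range_toInduced_wordProd hbc χ).ge

theorem basis_apply (hρ : Function.Injective ρ) (hbc : ∀ i, b (Sum.inr i) = c i) (χ : B →ₗ⁅K⁆ K)
    (s : Multiset κ) :
    basis hρ hbc χ s = toInduced χ (wordProd K (b ∘ Sum.inl) s.toList) :=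
  Module.Basis.mk_apply _ _ s

theorem ι_smul_basis (hρ : Function.Injective ρ) (hbc : ∀ i, b (Sum.inr i) = c i)
    (χ : B →ₗ⁅K⁆ K) {h : B} {α : κ → K} (hα : ∀ i, ⁅(h : L), b (Sum.inl i)⁆ = α i • b (Sum.inl i))
    (s : Multiset κ) :
    ι K (h : L) • basis hρ hbc χ s = (χ h + (s.map α).sum) • basis hρ hbc χ s := by
  have hsum : (s.toList.map α).sum = (s.map α).sum := by
    rw [← Multiset.sum_coe, ← Multiset.map_coe, Multiset.coe_toList]
  rw [basis_apply, ← toInduced_mul, ι_mul_wordProd (x := b ∘ Sum.inl) hα, map_add,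
    toInduced_mul_ι, map_smul, hsum, add_smul]

end Basis

end InducedModule

namespace VermaSl

open UniversalEnvelopingAlgebra Module LieAlgebra.SpecialLinear

attribute [local instance 100] LieRing.ofAssociativeRing

section WeightSpaces

variable {R L M σ : Type*} [CommRing R] [IsDomain R] [LieRing L] [LieAlgebra R L]
  [AddCommGroup M] [Module R M] [LieRingModule L M] [LieModule R L M]
  (b : Basis σ R M) {w : σ → L → R}

theorem weightSpace_eq_span (hb : ∀ x i, ⁅x, b i⁆ = w i x • b i) (μ : L → R) :
    (LieModule.weightSpace M μ).toSubmodule = Submodule.span R (b '' {i | w i = μ}) := by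
  refine le_antisymm (fun v hv => ?_) (Submodule.span_le.2 ?_)
  · have hlie (x : L) (i : σ) : b.repr ⁅x, v⁆ i = w i x * b.repr v i := by
      suffices h : b.coord i ∘ₗ (LieModule.toEnd R L M x) = w i x • b.coord i from
        LinearMap.congr_fun h v
      refine b.ext fun j => ?_
      obtain rfl | hij := eq_or_ne j i <;> simp [*]
    refine b.mem_span_image.2 fun i hi => funext fun x => ?_
    refine mul_right_cancel₀ (Finsupp.mem_support_iff.1 hi) ?_
    rw [← hlie, (LieModule.mem_weightSpace μ v).1 hv, map_smul, Finsupp.smul_apply, smul_eq_mul]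
  · rintro _ ⟨i, rfl, rfl⟩
    exact (LieModule.mem_weightSpace _ _).2 fun x => hb x i

/-- The basis of a weight space formed by the weight vectors of that weight in a basis of the whole
module. -/
def weightSpaceBasis (hb : ∀ x i, ⁅x, b i⁆ = w i x • b i) (μ : L → R) :
    Basis {i | w i = μ} R (LieModule.weightSpace M μ).toSubmodule :=
  (Basis.span (b.linearIndependent.comp _ Subtype.val_injective)).map <| LinearEquiv.ofEq _ _ <| by
    rw [weightSpace_eq_span b hb, Set.image_eq_range]
    rfl

end WeightSpaces

variable {m : ℕ}

/-- The Borel subalgebra of upper triangular matrices. -/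
def borel (m : ℕ) : LieSubalgebra ℂ (SL m) where
  carrier := {x | x.val.BlockTriangular id}
  add_mem' hx hy := hx.add hy
  zero_mem' := Matrix.blockTriangular_zero
  smul_mem' c x hx i j h := by
    change c * x.val i j = 0
    rw [hx h, mul_zero]
  lie_mem' hx hy := (hx.mul hy).sub (hy.mul hx)

/-- The diagonal part of an upper triangular matrix. -/
def diagPart : borel m →ₗ[ℂ] cartan m where
  toFun x := ⟨⟨Matrix.diagonal x.val.val.diag,
    (Matrix.trace_diagonal x.val.val.diag).trans x.val.2⟩, Matrix.isDiag_diagonal _⟩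
  map_add' _ _ := Subtype.ext (Subtype.ext (Matrix.diagonal_add _ _).symm)
  map_smul' c _ := Subtype.ext (Subtype.ext (Matrix.diagonal_smul c _))

theorem diagPart_of_isDiag {x : borel m} (hx : x.val.val.IsDiag) : (diagPart x : SL m) = x :=
  Subtype.ext ((Matrix.isDiag_iff_diagonal_diag _).1 hx)

theorem diag_mul_of_blockTriangular {R n : Type*} [NonUnitalNonAssocSemiring R] [Fintype n]
    [LinearOrder n] {A B : Matrix n n R} (hA : A.BlockTriangular id) (hB : B.BlockTriangular id) :
    (A * B).diag = A.diag * B.diag := by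
  funext i
  rw [Matrix.diag_apply, Matrix.mul_apply]
  refine Finset.sum_eq_single i (fun k _ hk => ?_) (by simp)
  rcases lt_or_gt_of_ne hk with h | h
  · rw [hA h, zero_mul]
  · rw [hB h, mul_zero]

theorem diagPart_lie (x y : borel m) : diagPart ⁅x, y⁆ = 0 := by
  refine Subtype.ext (Subtype.ext ?_)
  change Matrix.diagonal (x.val.val * y.val.val - y.val.val * x.val.val).diag = 0
  rw [Matrix.diag_sub, diag_mul_of_blockTriangular x.2 y.2, diag_mul_of_blockTriangular y.2 x.2,
    mul_comm, sub_self]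
  exact Matrix.diagonal_zero

/-- The character of the Borel subalgebra determined by a weight. -/
def borelCharacter (l : weightLattice m) : borel m →ₗ⁅ℂ⁆ ℂ :=
  { l.val.comp diagPart with
    map_lie' {x y} := by
      change l.val (diagPart ⁅x, y⁆) = ⁅l.val (diagPart x), l.val (diagPart y)⁆
      rw [diagPart_lie, map_zero, LieRing.of_associative_ring_bracket, mul_comm, sub_self] }

theorem borelCharacter_apply (l : weightLattice m) (x : borel m) :
    borelCharacter l x = l.val (diagPart x) := rfl

/-- The inclusion of diagonal matrices in upper triangular ones. -/
def cartanToBorel (h : cartan m) : borel m := ⟨h, fun _ _ hij => h.2 (ne_of_gt hij)⟩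

theorem borelCharacter_cartanToBorel (l : weightLattice m) (h : cartan m) :
    borelCharacter l (cartanToBorel h) = l.val h :=
  congrArg l.val (Subtype.ext (diagPart_of_isDiag h.2))

theorem vermaIdeal_eq_characterIdeal (l : weightLattice m) :
    vermaIdeal l = InducedModule.characterIdeal (borelCharacter l) := by
  refine le_antisymm (Submodule.span_le.2 ?_) (Submodule.span_le.2 ?_)
  · rintro _ (⟨x, hx, rfl⟩ | ⟨h, rfl⟩)
    · have hdiag : x.val.diag = 0 := funext fun i => hx i i le_rfl
      have hzero : borelCharacter l ⟨x, fun i j hij => hx i j (le_of_lt hij)⟩ = 0 := by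
        have h : diagPart (⟨x, fun i j hij => hx i j (le_of_lt hij)⟩ : borel m) = 0 :=
          Subtype.ext (Subtype.ext ((congrArg Matrix.diagonal hdiag).trans Matrix.diagonal_zero))
        rw [borelCharacter_apply, h, map_zero]
      refine Submodule.subset_span ⟨_, (congrArg (ι ℂ x - algebraMap ℂ _ ·) hzero).trans ?_⟩
      rw [map_zero, sub_zero]
    · rw [← borelCharacter_cartanToBorel]
      exact Submodule.subset_span ⟨cartanToBorel h, rfl⟩
  · rintro _ ⟨y, rfl⟩
    have hupper : ι ℂ (y.val - (diagPart y : SL m)) ∈ vermaIdeal l := by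
      refine Submodule.subset_span (Or.inl ⟨_, fun i j hij => ?_, rfl⟩)
      change y.val.val i j - Matrix.diagonal y.val.val.diag i j = 0
      rcases hij.lt_or_eq with h | rfl
      · rw [y.2 h, Matrix.diagonal_apply_ne _ h.ne', sub_zero]
      · rw [Matrix.diagonal_apply_eq, Matrix.diag_apply, sub_self]
    have hdiag : ι ℂ (diagPart y : SL m) - algebraMap ℂ _ (l.val (diagPart y)) ∈ vermaIdeal l :=
      Submodule.subset_span (Or.inr ⟨_, rfl⟩)
    have h := add_mem hupper hdiag
    rwa [map_sub, sub_add_sub_cancel] at h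

/-- The index type of the negative roots `eᵢ - eⱼ`, `i > j`. -/
abbrev NegRoot (m : ℕ) : Type := {p : Fin m × Fin m // p.2 < p.1}

/-- The negative root with a given index, as an integral weight. -/
def negRoot (p : NegRoot m) : weightLattice m := e p.val.1 - e p.val.2

/-- The matrix unit spanning the root space of a negative root. -/
def lowerUnit (p : NegRoot m) : SL m := single p.val.1 p.val.2 p.2.ne' 1

theorem lie_lowerUnit (h : cartan m) (p : NegRoot m) :
    ⁅(h : SL m), lowerUnit p⁆ = (negRoot p).val h • lowerUnit p := by
  refine Subtype.ext ?_
  change h.val.val * Matrix.single p.val.1 p.val.2 1 - Matrix.single p.val.1 p.val.2 1 * h.val.val =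
    (h.val.val p.val.1 p.val.1 - h.val.val p.val.2 p.val.2) • Matrix.single p.val.1 p.val.2 (1 : ℂ)
  rw [← (Matrix.isDiag_iff_diagonal_diag _).1 h.2]
  ext i j
  rw [Matrix.sub_apply, Matrix.diagonal_mul, Matrix.mul_diagonal, Matrix.smul_apply,
    Matrix.single_apply]
  split_ifs with hij
  · obtain ⟨rfl, rfl⟩ := hij
    simp
  · simp

/-- The strictly lower triangular matrix with given entries below the diagonal. -/
def lowering : (NegRoot m → ℂ) →ₗ[ℂ] SL m where
  toFun a := ⟨Matrix.of fun i j => if h : j < i then a ⟨(i, j), h⟩ else 0, by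
    change Matrix.trace (n := Fin m) _ = 0
    simp [Matrix.trace]⟩
  map_add' a b := by
    refine Subtype.ext (Matrix.ext fun i j => ?_)
    change (if h : j < i then (a + b) ⟨(i, j), h⟩ else 0) =
      (if h : j < i then a ⟨(i, j), h⟩ else 0) + (if h : j < i then b ⟨(i, j), h⟩ else 0)
    split_ifs <;> simp
  map_smul' c a := by
    refine Subtype.ext (Matrix.ext fun i j => ?_)
    change (if h : j < i then (c • a) ⟨(i, j), h⟩ else 0) =
      c * (if h : j < i then a ⟨(i, j), h⟩ else 0)
    split_ifs <;> simp

theorem lowering_apply (a : NegRoot m → ℂ) {i j : Fin m} (h : j < i) :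
    (lowering a).val i j = a ⟨(i, j), h⟩ :=
  dif_pos h

theorem lowering_single (p : NegRoot m) : lowering (Pi.single p 1) = lowerUnit p := by
  refine Subtype.ext (Matrix.ext fun i j => ?_)
  change (if h : j < i then (Pi.single p 1 : NegRoot m → ℂ) ⟨(i, j), h⟩ else 0) =
    Matrix.single p.val.1 p.val.2 1 i j
  have := p.2
  simp only [Pi.single_apply, Matrix.single_apply, Subtype.ext_iff, Prod.ext_iff]
  grind

/-- The decomposition of `𝔰𝔩ₘ` into strictly lower triangular and upper triangular matrices. -/
def triangularEquiv (m : ℕ) : ((NegRoot m → ℂ) × borel m) ≃ₗ[ℂ] SL m :=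
  .ofBijective (lowering.coprod (borel m).toSubmodule.subtype) <| by
    refine ⟨(injective_iff_map_eq_zero _).2 fun ⟨a, y⟩ h => ?_, fun x => ?_⟩
    · have ha : a = 0 := by
        funext p
        have hp : (lowering a).val p.val.1 p.val.2 + y.val.val p.val.1 p.val.2 = 0 :=
          congrArg (fun x : SL m => x.val p.val.1 p.val.2) h
        rwa [y.2 p.2, add_zero, lowering_apply a p.2] at hp
      subst ha
      simpa using h
    · let a : NegRoot m → ℂ := fun p => x.val p.val.1 p.val.2
      refine ⟨(a, ⟨x - lowering a, fun i j h => ?_⟩), by simp⟩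
      change x.val i j - (lowering a).val i j = 0
      rw [lowering_apply a (show j < i from h), sub_self]

theorem triangularEquiv_apply (p : (NegRoot m → ℂ) × borel m) :
    triangularEquiv m p = lowering p.1 + p.2 := rfl

/-- The basis of `𝔰𝔩ₘ` made of the matrix units of the negative roots and of a basis of the Borel
subalgebra. -/
def triangularBasis (m : ℕ) : Basis (NegRoot m ⊕ Fin (finrank ℂ (borel m))) ℂ (SL m) :=
  ((Pi.basisFun ℂ (NegRoot m)).prod (finBasis ℂ (borel m))).map (triangularEquiv m)

theorem triangularBasis_inl (p : NegRoot m) : triangularBasis m (Sum.inl p) = lowerUnit p := by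
  simp [triangularBasis, triangularEquiv_apply, lowering_single]

theorem triangularBasis_inr (i : Fin (finrank ℂ (borel m))) :
    triangularBasis m (Sum.inr i) = finBasis ℂ (borel m) i := by
  simp [triangularBasis, triangularEquiv_apply]

/-- The basis of the Verma module made of the monomials in the matrix units of the negative
roots. -/
def vermaBasis (l : weightLattice m) : Basis (Multiset (NegRoot m)) ℂ (Verma l) :=
  (InducedModule.basis (ρ := (SL m).incl) Subtype.val_injective triangularBasis_inr
      (borelCharacter l)).map
    ((Submodule.quotEquivOfEq _ _ (vermaIdeal_eq_characterIdeal l).symm).restrictScalars ℂ)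

theorem val_multiset_sum (s : Multiset (weightLattice m)) (h : cartan m) :
    s.sum.val h = (s.map fun μ => μ.val h).sum :=
  map_multiset_sum (((LinearMap.applyₗ h).toAddMonoidHom).comp (weightLattice m).subtype) s

theorem lie_vermaBasis (l : weightLattice m) (h : cartan m) (s : Multiset (NegRoot m)) :
    ⁅h, vermaBasis l s⁆ = (l + (s.map negRoot).sum).val h • vermaBasis l s := by
  have hlower (p : NegRoot m) : ⁅((cartanToBorel h : borel m) : SL m), triangularBasis m (.inl p)⁆ =
      (negRoot p).val h • triangularBasis m (.inl p) := by
    rw [triangularBasis_inl]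
    exact lie_lowerUnit h p
  have hsum : (l + (s.map negRoot).sum).val h =
      borelCharacter l (cartanToBorel h) + (s.map fun p => (negRoot p).val h).sum := by
    rw [borelCharacter_cartanToBorel, AddSubgroup.coe_add, LinearMap.add_apply, val_multiset_sum,
      Multiset.map_map]
    rfl
  rw [hsum]
  have key := InducedModule.ι_smul_basis (ρ := (SL m).incl) Subtype.val_injective
    triangularBasis_inr (borelCharacter l) hlower s
  let E := Submodule.quotEquivOfEq _ _ (vermaIdeal_eq_characterIdeal l).symm
  change ι ℂ (h : SL m) • E _ = _ • E _
  rw [← map_smul]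
  exact (congrArg E key).trans ((E.restrictScalars ℂ).map_smul _ _)

end VermaSl

namespace Lorentzian

open Matrix

section QuadraticForms

variable {ι R : Type*} [Fintype ι] [CommRing R] {A : Matrix ι ι R}

theorem mulVec_add_smul_single [DecidableEq ι] (A : Matrix ι ι R) (i j : ι) (x : ι → R) (s : R) :
    (A *ᵥ (x + s • Pi.single j 1)) i = (A *ᵥ x) i + s * A i j := by
  simp [mulVec_add, mulVec_smul]

theorem dotProduct_mulVec_add_smul_single [DecidableEq ι] (hA : A.IsSymm) (i : ι) (x : ι → R)
    (s : R) :
    (x + s • Pi.single i 1) ⬝ᵥ A *ᵥ (x + s • Pi.single i 1) =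
      x ⬝ᵥ A *ᵥ x + 2 * s * (A *ᵥ x) i + s ^ 2 * A i i := by
  have hcol : x ⬝ᵥ A.col i = (A *ᵥ x) i := by
    rw [dotProduct_comm]
    exact congrArg (· ⬝ᵥ x) (funext fun k => hA.apply i k)
  simp only [add_dotProduct, smul_dotProduct, single_one_dotProduct, mulVec_add, mulVec_smul,
    dotProduct_add, dotProduct_smul, mulVec_single_one, hcol, smul_eq_mul, col_apply]
  ring

variable [LinearOrder R]

/-- The quadratic form of `A` is nonpositive on the orthogonal complement, with respect to the form,
of the `i`-th coordinate vector. For symmetric `A` with `A i i > 0` this says that `A` has exactly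
one positive eigenvalue. -/
def NonposOnOrthogonal (A : Matrix ι ι R) (i : ι) : Prop :=
  ∀ x, (A *ᵥ x) i = 0 → x ⬝ᵥ A *ᵥ x ≤ 0

variable [IsStrictOrderedRing R] {i : ι}

theorem NonposOnOrthogonal.smul (h : NonposOnOrthogonal A i) {r : R} (hr : 0 < r) :
    NonposOnOrthogonal (r • A) i := by
  intro x hx
  rw [smul_mulVec, Pi.smul_apply, smul_eq_zero_iff_right hr.ne'] at hx
  rw [smul_mulVec, dotProduct_smul]
  exact smul_nonpos_of_nonneg_of_nonpos hr.le (h x hx)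

theorem NonposOnOrthogonal.mul_diag_le_sq (h : NonposOnOrthogonal A i) (hA : A.IsSymm)
    (hi : 0 < A i i) (j : ι) : A i i * A j j ≤ A i j ^ 2 := by
  classical
  have hx := h (0 + A i i • Pi.single j 1 + (-A i j) • Pi.single i 1) (by
    simp only [mulVec_add_smul_single, mulVec_zero, Pi.zero_apply]
    ring)
  simp only [dotProduct_mulVec_add_smul_single hA, mulVec_add_smul_single, mulVec_zero,
    Pi.zero_apply, dotProduct_zero] at hx
  refine le_of_mul_le_mul_left ?_ hi
  linarith

theorem nonposOnOrthogonal_vecMulVec_sub_diagonal [DecidableEq ι] {v : ι → R} (hv : v i ≠ 0)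
    {ε : R} (h0 : 0 ≤ ε) (h1 : ε ≤ 1) :
    NonposOnOrthogonal (vecMulVec v v - ε • diagonal (v ^ 2)) i := by
  intro x hx
  have hmul (k : ι) : ((vecMulVec v v - ε • diagonal (v ^ 2)) *ᵥ x) k =
      v k * (v ⬝ᵥ x - ε * (v k * x k)) := by
    simp only [sub_mulVec, vecMulVec_mulVec, op_smul_eq_smul, smul_mulVec, Pi.sub_apply,
      Pi.smul_apply, smul_eq_mul, mulVec_diagonal, Pi.pow_apply]
    ring
  have hT : v ⬝ᵥ x = ε * (v i * x i) := by
    rw [hmul, mul_eq_zero_iff_left hv, sub_eq_zero] at hx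
    exact hx
  have hquad : x ⬝ᵥ (vecMulVec v v - ε • diagonal (v ^ 2)) *ᵥ x =
      (v ⬝ᵥ x) ^ 2 - ε * ∑ k, (v k * x k) ^ 2 := by
    calc x ⬝ᵥ (vecMulVec v v - ε • diagonal (v ^ 2)) *ᵥ x
        = ∑ k, (v k * x k * (v ⬝ᵥ x) - ε * (v k * x k) ^ 2) :=
          Finset.sum_congr rfl fun k _ => by rw [hmul]; ring
      _ = (v ⬝ᵥ x) ^ 2 - ε * ∑ k, (v k * x k) ^ 2 := by
          rw [Finset.sum_sub_distrib, ← Finset.sum_mul, ← Finset.mul_sum, sq (v ⬝ᵥ x)]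
          rfl
  rw [hquad, hT, sub_nonpos]
  calc (ε * (v i * x i)) ^ 2 = ε * (ε * (v i * x i) ^ 2) := by ring
    _ ≤ ε * (1 * (v i * x i) ^ 2) := by gcongr
    _ ≤ ε * ∑ k, (v k * x k) ^ 2 := by
      rw [one_mul]
      gcongr
      exact Finset.single_le_sum (f := fun k => (v k * x k) ^ 2) (fun _ _ => sq_nonneg _)
        (Finset.mem_univ i)

variable {𝕜 : Type*} [Field 𝕜] [LinearOrder 𝕜] [IsStrictOrderedRing 𝕜] {j : ι}

theorem NonposOnOrthogonal.of_ne_zero {A : Matrix ι ι 𝕜} (h : NonposOnOrthogonal A i)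
    (hA : A.IsSymm) (hij : A i j ≠ 0) (hj : 0 ≤ A j j) : NonposOnOrthogonal A j := by
  classical
  intro x hx
  set t := -(A *ᵥ x) i / A i j
  have hz := h (x + t • Pi.single j 1) (by
    rw [mulVec_add_smul_single, div_mul_cancel₀ _ hij, add_neg_cancel])
  rw [dotProduct_mulVec_add_smul_single hA, hx] at hz
  linarith [mul_nonneg (sq_nonneg t) hj]

/-- Each summand is tested on `x + a k • eᵢ - a (k + 1) • eⱼ`, the coefficients `a k` being chosen
so that this vector is orthogonal to `eᵢ` for `A k`; the resulting bounds telescope. -/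
theorem nonposOnOrthogonal_sum_range {A : ℕ → Matrix ι ι 𝕜} (hA : ∀ k, (A k).IsSymm)
    (hpos : ∀ k, 0 < A k i i) (hrow : ∀ k, A k j = A (k + 1) i)
    (h : ∀ k, NonposOnOrthogonal (A k) i) (n : ℕ) :
    NonposOnOrthogonal (∑ k ∈ Finset.range n, A k) i := by
  classical
  intro x hx
  let r (k : ℕ) : 𝕜 := (A k *ᵥ x) i
  let g (k : ℕ) : 𝕜 := A k i i
  let a (k : ℕ) : 𝕜 := (∑ l ∈ Finset.range k, r l) / g k
  let Φ (k : ℕ) : 𝕜 := 2 * a k * r k + a k ^ 2 * (g k - g (k + 1))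
  have ha (k : ℕ) : a k * g k = ∑ l ∈ Finset.range k, r l := div_mul_cancel₀ _ (hpos k).ne'
  have hji (k : ℕ) : A k j i = g (k + 1) := congrFun (hrow k) i
  have hij (k : ℕ) : A k i j = g (k + 1) := ((hA k).apply j i).trans (hji k)
  have hjj (k : ℕ) : A k j j = g (k + 2) := (congrFun (hrow k) j).trans (hij (k + 1))
  have hr (k : ℕ) : (A k *ᵥ x) j = r (k + 1) := congrArg (· ⬝ᵥ x) (hrow k)
  have bound (k : ℕ) : x ⬝ᵥ A k *ᵥ x ≤ Φ (k + 1) - Φ k := by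
    have hy := h k (x + a k • Pi.single i 1 + (-a (k + 1)) • Pi.single j 1) (by
      rw [mulVec_add_smul_single, mulVec_add_smul_single, hij]
      linear_combination ha k - ha (k + 1) - Finset.sum_range_succ r k)
    simp only [dotProduct_mulVec_add_smul_single (hA k), mulVec_add_smul_single, hr, hji, hjj]
      at hy
    have hsq : 0 ≤ g (k + 1) * (a k - a (k + 1)) ^ 2 :=
      mul_nonneg (hpos (k + 1)).le (sq_nonneg _)
    linear_combination hy + hsq
  have h0 : Φ 0 = 0 := by simp [Φ, a]
  have hn : Φ n = 0 := by
    have : a n = 0 := by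
      rw [sum_mulVec, Finset.sum_apply] at hx
      exact div_eq_zero_iff.2 (Or.inl hx)
    simp [Φ, this]
  calc x ⬝ᵥ (∑ k ∈ Finset.range n, A k) *ᵥ x
      = ∑ k ∈ Finset.range n, x ⬝ᵥ A k *ᵥ x := by rw [sum_mulVec, dotProduct_sum]
    _ ≤ ∑ k ∈ Finset.range n, (Φ (k + 1) - Φ k) := Finset.sum_le_sum fun k _ => bound k
    _ = 0 := by rw [Finset.sum_range_sub, h0, hn, sub_zero]

end QuadraticForms

section Functions

variable {ι 𝕜 M : Type*} [AddCommGroup M] {e : ι → M} {c : M → 𝕜}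

/-- The matrix of second translates of a function `c` at `α`, in the directions `e i`. On the
lattice `ℤ^ι` it is the Hessian at the origin of the `α`-th derivative of `∑ c(β) x^β / β!`. -/
def hessian (e : ι → M) (c : M → 𝕜) (α : M) : Matrix ι ι 𝕜 := of fun i j => c (α + e i + e j)

theorem hessian_apply (e : ι → M) (c : M → 𝕜) (α : M) (i j : ι) :
    hessian e c α i j = c (α + e i + e j) := rfl

theorem hessian_isSymm (e : ι → M) (c : M → 𝕜) (α : M) : (hessian e c α).IsSymm :=
  .ext fun i j => by rw [hessian_apply, hessian_apply, add_right_comm]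

variable [Fintype ι] [Field 𝕜] [LinearOrder 𝕜] [IsStrictOrderedRing 𝕜]

/-- Positive functions all of whose matrices of second translates have exactly one positive
eigenvalue. -/
structure IsLorentzian (e : ι → M) (c : M → 𝕜) : Prop where
  pos : ∀ β, 0 < c β
  nonposOnOrthogonal : ∀ α i, NonposOnOrthogonal (hessian e c α) i

theorem IsLorentzian.mul_le_sq (hc : IsLorentzian e c) (α : M) (i j : ι) :
    c (α + e i + e i) * c (α + e j + e j) ≤ c (α + e i + e j) ^ 2 :=
  (hc.nonposOnOrthogonal α i).mul_diag_le_sq (hessian_isSymm e c α) (hc.pos _) j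

theorem isLorentzian_of_nonposOnOrthogonal (hc : ∀ β, 0 < c β) (i : ι)
    (h : ∀ α, NonposOnOrthogonal (hessian e c α) i) : IsLorentzian e c where
  pos := hc
  nonposOnOrthogonal α _ := (h α).of_ne_zero (hessian_isSymm e c α) (hc _).ne' (hc _).le

theorem IsLorentzian.sum_translates (hc : IsLorentzian e c) (i j : ι) (n : ℕ) :
    IsLorentzian e fun β => ∑ k ∈ Finset.range (n + 1), c (β - k • (e i - e j)) := by
  refine isLorentzian_of_nonposOnOrthogonal
    (fun β => Finset.sum_pos (fun k _ => hc.pos _) Finset.nonempty_range_add_one) i fun α => ?_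
  let A (k : ℕ) : Matrix ι ι 𝕜 := hessian e c (α - k • (e i - e j))
  have hsum : hessian e (fun β => ∑ k ∈ Finset.range (n + 1), c (β - k • (e i - e j))) α =
      ∑ k ∈ Finset.range (n + 1), A k := by
    ext p q
    rw [Matrix.sum_apply, hessian_apply]
    refine Finset.sum_congr rfl fun k _ => congrArg c ?_
    abel
  have hrow (k : ℕ) : A k j = A (k + 1) i := by
    refine funext fun p => congrArg c ?_
    rw [succ_nsmul]
    abel
  rw [hsum]
  exact nonposOnOrthogonal_sum_range (fun k => hessian_isSymm e c _) (fun k => hc.pos _) hrow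
    (fun k => hc.nonposOnOrthogonal _ i) (n + 1)

end Functions

section BoxSums

variable {τ N : Type*} [Fintype τ] [DecidableEq τ]

theorem sum_Iic_eq_sum_range_sum_Iic_update [AddCommMonoid N] (u : τ → ℕ) (p : τ)
    (F : (τ → ℕ) → N) :
    ∑ f ∈ Finset.Iic u, F f =
      ∑ k ∈ Finset.range (u p + 1), ∑ f ∈ Finset.Iic (Function.update u p 0),
        F (f + Pi.single p k) := by
  have hsplit (f : τ → ℕ) : Function.update f p 0 + Pi.single p (f p) = f := by
    funext q
    obtain rfl | hq := eq_or_ne q p <;> simp [*]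
  rw [← Finset.sum_product']
  refine Finset.sum_nbij' (fun f => (f p, Function.update f p 0))
    (fun x => x.2 + Pi.single p x.1) ?_ ?_ (fun f _ => hsplit f) ?_
    (fun f _ => congrArg F (hsplit f).symm)
  · intro f hf
    have hf : f ≤ u := Finset.mem_Iic.1 hf
    exact Finset.mem_product.2 ⟨Finset.mem_range_succ_iff.2 (hf p),
      Finset.mem_Iic.2 (update_le_update_iff.2 ⟨le_rfl, fun q _ => hf q⟩)⟩
  · rintro ⟨k, f⟩ hx
    simp only [Finset.mem_product, Finset.mem_range_succ_iff, Finset.mem_Iic, le_update_iff,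
      nonpos_iff_eq_zero] at hx ⊢
    intro q
    obtain rfl | hq := eq_or_ne q p <;> simp [*]
  · rintro ⟨k, f⟩ hx
    simp only [Finset.mem_product, Finset.mem_Iic, le_update_iff, nonpos_iff_eq_zero] at hx
    refine Prod.ext (by simp [hx]) (funext fun q => ?_)
    obtain rfl | hq := eq_or_ne q p <;> simp [*]

variable {ι 𝕜 M : Type*} [AddCommGroup M] {e : ι → M} {c : M → 𝕜}
  [Fintype ι] [Field 𝕜] [LinearOrder 𝕜] [IsStrictOrderedRing 𝕜]

theorem IsLorentzian.sum_Iic (hc : IsLorentzian e c) (a b : τ → ι) (u : τ → ℕ) :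
    IsLorentzian e fun β => ∑ f ∈ Finset.Iic u, c (β - ∑ p, f p • (e (a p) - e (b p))) := by
  suffices h : ∀ (s : Finset τ) (u : τ → ℕ), (∀ p ∉ s, u p = 0) →
      IsLorentzian e fun β => ∑ f ∈ Finset.Iic u, c (β - ∑ p, f p • (e (a p) - e (b p))) from
    h Finset.univ u fun p hp => absurd (Finset.mem_univ p) hp
  intro s
  induction s using Finset.induction_on with
  | empty =>
    intro u hu
    obtain rfl : u = 0 := funext fun p => hu p (Finset.notMem_empty p)
    have : Finset.Iic (0 : τ → ℕ) = {0} := Finset.Iic_bot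
    simpa [this] using hc
  | insert p s _ ih =>
    intro u hu
    have hu' : ∀ q ∉ s, Function.update u p 0 q = 0 := by
      intro q hq
      obtain rfl | hqp := eq_or_ne q p
      · exact Function.update_self ..
      · rw [Function.update_of_ne hqp]
        exact hu q (by simp [hq, hqp])
    convert (ih _ hu').sum_translates (a p) (b p) (u p) using 2 with β
    rw [sum_Iic_eq_sum_range_sum_Iic_update u p]
    refine Finset.sum_congr rfl fun k _ => Finset.sum_congr rfl fun f _ => congrArg c ?_
    simp only [Pi.add_apply, add_smul, Finset.sum_add_distrib, Pi.single_apply, ite_smul, zero_smul,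
      Finset.sum_ite_eq', Finset.mem_univ, if_true]
    abel

end BoxSums

section Gaussian

variable {ι : Type*} [Fintype ι]

/-- The discrete Gaussian `q ^ |β|²`, a positive function on the lattice for `q > 0` which tends to
the indicator function of the origin as `q → 0`. -/
def gauss (q : ℝ) (β : ι → ℤ) : ℝ := q ^ ∑ i, (β i).natAbs ^ 2

theorem gauss_eq_zpow (q : ℝ) (β : ι → ℤ) : gauss q β = q ^ (∑ i, β i ^ 2) := by
  rw [gauss, ← zpow_natCast]
  push_cast
  simp only [sq_abs]

theorem gauss_zero (β : ι → ℤ) : gauss 0 β = if β = 0 then 1 else 0 := by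
  simp [gauss, zero_pow_eq, funext_iff]

variable [DecidableEq ι]

theorem gauss_add_single_add_single {q : ℝ} (hq : q ≠ 0) (α : ι → ℤ) (i j : ι) :
    gauss q (α + Pi.single i 1 + Pi.single j 1) =
      q ^ (∑ k, α k ^ 2 + 2) * (q ^ (2 * α i) * q ^ (2 * α j) * if i = j then q ^ 2 else 1) := by
  have hsq (k : ι) : (α + Pi.single i 1 + Pi.single j 1 : ι → ℤ) k ^ 2 =
      α k ^ 2 + (if k = i then 2 * α k + 1 else 0) + (if k = j then 2 * α k + 1 else 0) +
        if k = i then if k = j then 2 else 0 else 0 := by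
    simp only [Pi.add_apply, Pi.single_apply]
    split_ifs <;> ring
  have hnorm : ∑ k, (α + Pi.single i 1 + Pi.single j 1 : ι → ℤ) k ^ 2 =
      (∑ k, α k ^ 2 + 2) + (2 * α i + 2 * α j + if i = j then 2 else 0) := by
    simp only [hsq, Finset.sum_add_distrib, Finset.sum_ite_eq', Finset.mem_univ, if_true]
    ring
  rw [gauss_eq_zpow, hnorm, zpow_add₀ hq, zpow_add₀ hq (2 * α i + 2 * α j), zpow_add₀ hq (2 * α i)]
  split_ifs <;> simp

theorem isLorentzian_gauss {q : ℝ} (hq : 0 < q) (hq1 : q ≤ 1) :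
    IsLorentzian (fun i : ι => Pi.single i 1) (gauss q) where
  pos _ := pow_pos hq _
  nonposOnOrthogonal α i := by
    let v (k : ι) : ℝ := q ^ (2 * α k)
    have hv (k : ι) : v k ≠ 0 := zpow_ne_zero _ hq.ne'
    have hessian_eq : hessian (fun i : ι => Pi.single i 1) (gauss q) α =
        q ^ (∑ k, α k ^ 2 + 2) • (vecMulVec v v - (1 - q ^ 2) • diagonal (v ^ 2)) := by
      ext k l
      rw [hessian_apply, gauss_add_single_add_single hq.ne']
      simp only [Matrix.smul_apply, Matrix.sub_apply, vecMulVec_apply, diagonal_apply, smul_eq_mul,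
        Pi.pow_apply]
      split_ifs with hkl
      · subst hkl
        ring
      · ring
    rw [hessian_eq]
    refine (nonposOnOrthogonal_vecMulVec_sub_diagonal (hv i) ?_ ?_).smul (zpow_pos hq _)
    · exact sub_nonneg.2 (pow_le_one₀ hq.le hq1)
    · exact sub_le_self 1 (sq_nonneg q)

end Gaussian

end Lorentzian

/-- The ways to write `β` as a combination of the `v p` with coefficients in `ℕ`. -/
def vectorPartitions {τ M : Type*} [Fintype τ] [AddCommMonoid M] (v : τ → M) (β : M) :
    Set (τ → ℕ) :=
  {c | ∑ p, c p • v p = β}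

namespace vectorPartitions

variable {τ : Type*} [Fintype τ]

theorem finite_of_pos {M : Type*} [AddCommMonoid M] {v : τ → M} (h : M →+ ℤ)
    (hv : ∀ p, 0 < h (v p)) (β : M) : (vectorPartitions v β).Finite := by
  classical
  refine (Set.finite_Iic fun _ => (h β).toNat).subset ?_
  rintro c rfl p
  have hsum : h (∑ q, c q • v q) = ∑ q, c q * h (v q) := by simp
  have hp : (c p : ℤ) ≤ h (∑ q, c q • v q) := by
    rw [hsum]
    calc (c p : ℤ) ≤ c p * h (v p) := le_mul_of_one_le_right (Nat.cast_nonneg _) (hv p)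
      _ ≤ ∑ q, c q * h (v q) := Finset.single_le_sum (f := fun q => c q * h (v q))
          (fun q _ => mul_nonneg (Nat.cast_nonneg _) (hv q).le) (Finset.mem_univ p)
  exact (Int.toNat_natCast (c p)).ge.trans (Int.toNat_le_toNat hp)

theorem map_of_injOn {M N : Type*} [AddCommMonoid M] [AddCommMonoid N] {f : M →+ N}
    {S : AddSubmonoid M} (hf : Set.InjOn f S) {v : τ → M} (hv : ∀ p, v p ∈ S) {β : M}
    (hβ : β ∈ S) : vectorPartitions (fun p => f (v p)) (f β) = vectorPartitions v β := by
  ext c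
  have hmap : ∑ p, c p • f (v p) = f (∑ p, c p • v p) := by simp
  have hmem : ∑ p, c p • v p ∈ S := sum_mem fun p _ => nsmul_mem (hv p) _
  exact (congrArg (· = f β) hmap).to_iff.trans (hf.eq_iff hmem hβ)

/-- The multisets with a given sum of the images of their elements under `v`, as families of
multiplicities. -/
def multisetEquiv [DecidableEq τ] {M : Type*} [AddCommMonoid M] (v : τ → M) (β : M) :
    {s : Multiset τ // (s.map v).sum = β} ≃ vectorPartitions v β :=
  (Multiset.toFinsupp.toEquiv.trans Finsupp.equivFunOnFinite).subtypeEquiv fun s => by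
    have hs : (s.map v).sum = ∑ p, s.count p • v p := by
      rw [Finset.sum_multiset_map_count]
      exact Finset.sum_subset (Finset.subset_univ _) fun p _ hp => by
        rw [Multiset.count_eq_zero.2 (mt Multiset.mem_toFinset.2 hp), zero_nsmul]
    rw [hs]
    simp [vectorPartitions]

open scoped Finset

variable {ι : Type*} [DecidableEq ι] {a b : τ → ι} {v : τ → ι → ℤ}

open Lorentzian in
theorem card_filter_Iic_log_concave [Fintype ι] [DecidableEq τ]
    (hv : ∀ p, v p = Pi.single (a p) 1 - Pi.single (b p) 1) (u : τ → ℕ) (α : ι → ℤ) (i j : ι) :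
    let N (β : ι → ℤ) : ℕ := #{f ∈ Finset.Iic u | ∑ p, f p • v p = β}
    N (α + Pi.single i 1 + Pi.single i 1) * N (α + Pi.single j 1 + Pi.single j 1) ≤
      N (α + Pi.single i 1 + Pi.single j 1) ^ 2 := by
  intro N
  let c (q : ℝ) (β : ι → ℤ) : ℝ := ∑ f ∈ Finset.Iic u, gauss q (β - ∑ p, f p • v p)
  have hc (q : ℝ) (hq : q ∈ Set.Ioc 0 1) : IsLorentzian (fun i : ι => Pi.single i 1) (c q) := by
    simpa only [c, hv] using (isLorentzian_gauss hq.1 hq.2).sum_Iic a b u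
  have hcont (β : ι → ℤ) : Continuous fun q => c q β := by
    unfold c gauss
    fun_prop
  have hzero (β : ι → ℤ) : c 0 β = N β := by
    simp only [c, N, gauss_zero, sub_eq_zero, eq_comm (a := β), Finset.sum_boole]
  have hlim : c 0 (α + Pi.single i 1 + Pi.single i 1) * c 0 (α + Pi.single j 1 + Pi.single j 1) ≤
      c 0 (α + Pi.single i 1 + Pi.single j 1) ^ 2 := by
    have hmem : (0 : ℝ) ∈ closure (Set.Ioc 0 1) := by
      rw [closure_Ioc zero_ne_one]
      exact Set.left_mem_Icc.2 zero_le_one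
    exact closure_minimal (fun q hq => (hc q hq).mul_le_sq α i j)
      (isClosed_le ((hcont _).mul (hcont _)) ((hcont _).pow 2)) hmem
  rw [hzero, hzero, hzero] at hlim
  exact_mod_cast hlim

theorem ncard_log_concave [Finite ι]
    (hv : ∀ p, v p = Pi.single (a p) 1 - Pi.single (b p) 1)
    (hfin : ∀ β, (vectorPartitions v β).Finite) (α : ι → ℤ) (i j : ι) :
    (vectorPartitions v (α + Pi.single i 1 + Pi.single i 1)).ncard *
        (vectorPartitions v (α + Pi.single j 1 + Pi.single j 1)).ncard ≤
      (vectorPartitions v (α + Pi.single i 1 + Pi.single j 1)).ncard ^ 2 := by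
  classical
  cases nonempty_fintype ι
  let β (k l : ι) : ι → ℤ := α + Pi.single k 1 + Pi.single l 1
  obtain ⟨u, hu⟩ := (Set.finite_iUnion fun k => Set.finite_iUnion fun l => hfin (β k l)).bddAbove
  have hcard (k l : ι) :
      (vectorPartitions v (β k l)).ncard = #{f ∈ Finset.Iic u | ∑ p, f p • v p = β k l} := by
    rw [← Set.ncard_coe_finset]
    congr 1
    ext f
    simp only [Finset.coe_filter, Finset.mem_Iic]
    exact ⟨fun hf => ⟨hu (Set.mem_iUnion₂.2 ⟨k, l, hf⟩), hf⟩, fun hf => hf.2⟩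
  rw [hcard, hcard, hcard]
  exact card_filter_Iic_log_concave hv u α i j

end vectorPartitions

namespace VermaSl

open Module

attribute [local instance 100] LieRing.ofAssociativeRing

variable {m : ℕ}

/-- The weight with given coefficients on the `eᵢ`. -/
def toWeight : (Fin m → ℤ) →+ weightLattice m where
  toFun β := ∑ i, β i • e i
  map_zero' := by simp
  map_add' β γ := by simp [add_smul, Finset.sum_add_distrib]

theorem toWeight_single (i : Fin m) : toWeight (Pi.single i 1) = e i :=
  (Fintype.sum_eq_single i fun j hj => by simp [hj]).trans (by simp)

theorem toWeight_apply_coroot (β : Fin m → ℤ) (i j : Fin m) :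
    (toWeight β).val (coroot i j) = β i - β j := by
  let f : weightLattice m →+ ℂ :=
    (LinearMap.applyₗ (coroot i j)).toAddMonoidHom.comp (weightLattice m).subtype
  have he (k : Fin m) : f (e k) = (if i = k then 1 else 0) - (if j = k then 1 else 0) := by
    change (Matrix.single i i 1 - Matrix.single j j 1 : Matrix (Fin m) (Fin m) ℂ) k k = _
    simp [Matrix.sub_apply, Matrix.single_apply]
  change f (∑ k, β k • e k) = _
  simp [map_sum, he, mul_sub]

/-- The vectors whose coordinates sum to zero. -/
def sumZero (m : ℕ) : AddSubgroup (Fin m → ℤ) :=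
  (∑ i, Pi.evalAddMonoidHom (fun _ : Fin m => ℤ) i).ker

theorem mem_sumZero {β : Fin m → ℤ} : β ∈ sumZero m ↔ ∑ i, β i = 0 := by
  simp [sumZero, AddMonoidHom.mem_ker]

theorem single_sub_single_mem_sumZero (i j : Fin m) :
    (Pi.single i 1 - Pi.single j 1 : Fin m → ℤ) ∈ sumZero m := by
  simp [mem_sumZero]

theorem toWeight_injOn_sumZero : Set.InjOn (toWeight (m := m)) (sumZero m) := by
  intro β hβ γ hγ h
  have hconst (i j : Fin m) : β j - γ j = β i - γ i := by
    have hij := toWeight_apply_coroot β i j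
    rw [h, toWeight_apply_coroot] at hij
    have hij' : γ i - γ j = β i - β j := by exact_mod_cast hij
    linarith
  funext i
  have hsum : (m : ℤ) * (β i - γ i) = 0 := by
    rw [← mem_sumZero.1 (sub_mem hβ hγ)]
    simp [hconst i, mul_sub]
  exact sub_eq_zero.1 ((mul_eq_zero.1 hsum).resolve_left (by exact_mod_cast i.pos.ne'))

/-- The coordinates of a negative root. -/
def rootVector (p : NegRoot m) : Fin m → ℤ := Pi.single p.val.1 1 - Pi.single p.val.2 1

theorem toWeight_rootVector (p : NegRoot m) : toWeight (rootVector p) = negRoot p := by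
  rw [rootVector, map_sub, toWeight_single, toWeight_single, negRoot]

theorem finite_vectorPartitions_rootVector (β : Fin m → ℤ) :
    (vectorPartitions rootVector β).Finite := by
  let height : (Fin m → ℤ) →+ ℤ := (dotProductBilin ℤ ℤ fun i : Fin m => (i : ℤ)).toAddMonoidHom
  refine vectorPartitions.finite_of_pos height (fun p => ?_) β
  have hheight : height (rootVector p) = (p.val.1 : ℤ) - p.val.2 := by
    simp [height, rootVector, dotProduct_sub]
  rw [hheight, sub_pos]
  exact_mod_cast p.2

theorem vectorPartitions_negRoot {β : Fin m → ℤ} (hβ : β ∈ sumZero m) :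
    vectorPartitions negRoot (toWeight β) = vectorPartitions rootVector β := by
  rw [← funext toWeight_rootVector]
  exact vectorPartitions.map_of_injOn (S := (sumZero m).toAddSubmonoid) toWeight_injOn_sumZero
    (fun p => single_sub_single_mem_sumZero _ _) hβ

theorem exists_toWeight_eq {c : NegRoot m → ℕ} {ν : weightLattice m}
    (hc : c ∈ vectorPartitions negRoot ν) : ∃ β ∈ sumZero m, toWeight β = ν := by
  refine ⟨∑ p, c p • rootVector p, sum_mem fun p _ => nsmul_mem
    (single_sub_single_mem_sumZero _ _) _, ?_⟩
  rw [← hc, map_sum]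
  exact Finset.sum_congr rfl fun p _ => by rw [map_nsmul, toWeight_rootVector]

theorem finite_vectorPartitions_negRoot (ν : weightLattice m) :
    (vectorPartitions negRoot ν).Finite := by
  obtain hempty | ⟨c, hc⟩ := (vectorPartitions negRoot ν).eq_empty_or_nonempty
  · exact hempty ▸ Set.finite_empty
  · obtain ⟨β, hβ, rfl⟩ := exists_toWeight_eq hc
    rw [vectorPartitions_negRoot hβ]
    exact finite_vectorPartitions_rootVector β

theorem vermaWeightSpace_finite_and_finrank (l μ : weightLattice m) :
    FiniteDimensional ℂ (vermaWeightSpace l μ) ∧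
      finrank ℂ (vermaWeightSpace l μ) = kostantPartition (μ - l) := by
  let w (s : Multiset (NegRoot m)) : cartan m → ℂ := (l + (s.map negRoot).sum).val
  let b : Basis {s | w s = μ.val} ℂ (vermaWeightSpace l μ) :=
    weightSpaceBasis (vermaBasis l) (lie_vermaBasis l) μ.val
  have hw (s : Multiset (NegRoot m)) : w s = μ.val ↔ (s.map negRoot).sum = μ - l := by
    rw [eq_sub_iff_add_eq', Subtype.ext_iff, DFunLike.coe_fn_eq]
  let E : {s | w s = μ.val} ≃ vectorPartitions negRoot (μ - l) :=
    (Equiv.subtypeEquivRight hw).trans (vectorPartitions.multisetEquiv negRoot (μ - l))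
  have : Finite (vectorPartitions negRoot (μ - l)) := finite_vectorPartitions_negRoot (μ - l)
  have : Finite {s | w s = μ.val} := .of_equiv _ E.symm
  exact ⟨.of_basis b, (finrank_eq_nat_card_basis b).trans (Nat.card_congr E)⟩

theorem kostantPartition_eq_ncard (ν : weightLattice m) :
    kostantPartition ν = (vectorPartitions negRoot ν).ncard := rfl

theorem kostantPartition_log_concave (ν : weightLattice m) (i j : Fin m) :
    kostantPartition (ν + e i - e j) * kostantPartition (ν + e j - e i) ≤
      kostantPartition ν ^ 2 := by
  obtain hempty | ⟨c, hc⟩ := (vectorPartitions negRoot (ν + e i - e j)).eq_empty_or_nonempty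
  · rw [kostantPartition_eq_ncard (ν + e i - e j), hempty, Set.ncard_empty, zero_mul]
    exact Nat.zero_le _
  obtain ⟨γ, hγ, hγν⟩ := exists_toWeight_eq hc
  set α : Fin m → ℤ := γ - Pi.single i 1 - Pi.single i 1 with hα
  have hcount (k l : Fin m) : kostantPartition (ν + e k + e l - e i - e j) =
      (vectorPartitions rootVector (α + Pi.single k 1 + Pi.single l 1)).ncard := by
    have hmem : α + Pi.single k 1 + Pi.single l 1 ∈ sumZero m := by
      convert add_mem (add_mem hγ (single_sub_single_mem_sumZero k i))
        (single_sub_single_mem_sumZero l i) using 1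
      rw [hα]
      abel
    rw [kostantPartition_eq_ncard, ← vectorPartitions_negRoot hmem]
    simp only [hα, map_add, map_sub, toWeight_single, hγν]
    congr 2
    abel
  have key := vectorPartitions.ncard_log_concave (v := rootVector (m := m)) (fun p => rfl)
    finite_vectorPartitions_rootVector α i j
  have hi : ν + e i + e i - e i - e j = ν + e i - e j := by abel
  have hj : ν + e j + e j - e i - e j = ν + e j - e i := by abel
  have hij : ν + e i + e j - e i - e j = ν := by abel
  rwa [← hcount, ← hcount, ← hcount, hi, hj, hij] at key

end VermaSl

end

theorem mainTheorem9 (m : ℕ) (l μ : VermaSl.weightLattice m) :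
    FiniteDimensional ℂ (VermaSl.vermaWeightSpace l μ) ∧
    Module.finrank ℂ (VermaSl.vermaWeightSpace l μ) = VermaSl.kostantPartition (μ - l) ∧
    ∀ i j : Fin m,
      Module.finrank ℂ (VermaSl.vermaWeightSpace l μ) ^ 2 ≥
        Module.finrank ℂ (VermaSl.vermaWeightSpace l (VermaSl.shift μ i j)) *
          Module.finrank ℂ (VermaSl.vermaWeightSpace l (VermaSl.shift μ j i)) := by
  have hfinrank := VermaSl.vermaWeightSpace_finite_and_finrank l
  have hshift (i j : Fin m) : VermaSl.shift μ i j - l = μ - l + VermaSl.e i - VermaSl.e j := by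
    rw [VermaSl.shift]
    abel
  refine ⟨(hfinrank μ).1, (hfinrank μ).2, fun i j => ?_⟩
  rw [(hfinrank μ).2, (hfinrank _).2, (hfinrank _).2, hshift, hshift]
  exact VermaSl.kostantPartition_log_concave (μ - l) i j
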